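/- Let $\alpha,\beta,\rho_0>0$ be real numbers with $\alpha\notin\mathbb{N}$. In the application to a satellite network assisted by reconfigurable intelligent surfaces, $\rho_0$ is the transmit SNR, and $\alpha=(\mathrm{E}|A|)^2/\mathrm{Var}|A|$, $\beta=\mathrm{Var}|A|/\mathrm{E}|A|$ for the combined channel response $A$. Let the SNR $\rho$ be a random variable with the (Gamma-approximated) density $$f_\rho(x)=\frac{1}{2\beta^{\alpha}\Gamma(\alpha)}\,\rho_0^{-\alpha/2}\,x^{\frac{\alpha-2}{2}}\exp\!\Big(-\sqrt{\tfrac{x}{\beta^2\rho_0}}\Big)\quad(x>0),\qquad f_\rho(x)=0\quad(x\le 0).$$ This is a probability density, $\log_2(1+\rho)$ is integrable, and the ergodic capacity is $$\begin{aligned}\mathrm{E}[\log_2(1+\rho)]=\frac{1}{\ln 2}\Bigg\{&\frac{\pi}{\alpha\Gamma(\alpha)}\Big(\frac{1}{\beta^2\rho_0}\Big)^{\frac{\alpha}{2}}\csc\Big(\frac{\pi\alpha}{2}\Big)\,{}_1F_2\Big(\frac{\alpha}{2};\frac12,1+\frac{\alpha}{2};-\frac{1}{4\beta^2\rho_0}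\Big)\\&+\frac{\Gamma(\alpha-2)}{\Gamma(\alpha)}\frac{1}{\beta^2\rho_0}\,{}_2F_3\Big(1,1;2,\frac32-\frac{\alpha}{2},2-\frac{\alpha}{2};-\frac{1}{4\beta^2\rho_0}\Big)\\&-\frac{1}{(1+\alpha)\Gamma(\alpha)}\Big[(2-\alpha-2\alpha^2+\alpha^3)\,\Gamma(\alpha-2)\Big(\ln\frac{1}{\beta^2\rho_0}-2\psi^{(0)}(\alpha)\Big)\\&\qquad+\pi\Big(\frac{1}{\beta^2\rho_0}\Big)^{\frac{1+\alpha}{2}}{}_1F_2\Big(\frac12+\frac{\alpha}{2};\frac32,\frac32+\frac{\alpha}{2};-\frac{1}{4\beta^2\rho_0}\Big)\sec\Big(\frac{\pi\alpha}{2}\Big)\Big]\Bigg\},\end{aligned}$$ where ${}_pF_q$ is the generalized hypergeometric function, given by its series (convergent for the arguments above), and $\psi^{(0)}=\Gamma'/\Gamma$ is the digamma function. -/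

import Mathlib

open MeasureTheory ProbabilityTheory

noncomputable section

/-- The density of the end-to-end SNR under the Gamma approximation of the channel amplitude
`|A|` (shape `α = (E|A|)² / Var|A|`, scale `β = Var|A| / E|A|`), with transmit SNR `ρ₀`:
`x ↦ (2 β^α Γ(α))⁻¹ ρ₀^(-α/2) x^((α-2)/2) exp (-√(x / (β² ρ₀)))` for `x > 0`, and `0` otherwise. -/
def snrPDF (α β ρ₀ x : ℝ) : ℝ :=
  if 0 < x then
    1 / (2 * β ^ α * Real.Gamma α) * ρ₀ ^ (-(α / 2)) * x ^ ((α - 2) / 2)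
      * Real.exp (-Real.sqrt (x / (β ^ 2 * ρ₀)))
  else 0

/-- The law on `ℝ` with density `snrPDF` with respect to Lebesgue measure. -/
def snrLaw (α β ρ₀ : ℝ) : Measure ℝ :=
  volume.withDensity (fun x => ENNReal.ofReal (snrPDF α β ρ₀ x))

/-- The `n`-th term of the generalized hypergeometric series with upper parameters `a` and lower
parameters `b`: `(∏ (aᵢ)ₙ / ∏ (bⱼ)ₙ) zⁿ / n!`, with `(c)ₙ` the rising factorial. -/
def hypergeometricTerm (a b : List ℝ) (z : ℝ) (n : ℕ) : ℝ :=
  (a.map fun c => (ascPochhammer ℝ n).eval c).prod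
    / (b.map fun c => (ascPochhammer ℝ n).eval c).prod * (z ^ n / (n.factorial : ℝ))

/-- The generalized hypergeometric function `ₚF_q (a; b; z)`, as the sum of its series. -/
def hypergeometricPFQ (a b : List ℝ) (z : ℝ) : ℝ :=
  ∑' n : ℕ, hypergeometricTerm a b z n

/-- The digamma function `ψ⁽⁰⁾` at a real argument. -/
def realDigamma (x : ℝ) : ℝ := (Complex.digamma (x : ℂ)).re

/-- The closed form of the ergodic capacity (in bits); here `csc t = (sin t)⁻¹` and
`sec t = (cos t)⁻¹`. -/
def capacityClosedForm (α β ρ₀ : ℝ) : ℝ :=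
  1 / Real.log 2 *
    (Real.pi / (α * Real.Gamma α) * (1 / (β ^ 2 * ρ₀)) ^ (α / 2) * (Real.sin (Real.pi * α / 2))⁻¹
        * hypergeometricPFQ [α / 2] [1 / 2, 1 + α / 2] (-(1 / (4 * β ^ 2 * ρ₀)))
      + Real.Gamma (α - 2) / Real.Gamma α * (1 / (β ^ 2 * ρ₀))
        * hypergeometricPFQ [1, 1] [2, 3 / 2 - α / 2, 2 - α / 2] (-(1 / (4 * β ^ 2 * ρ₀)))
      - 1 / (1 + α) * (1 / Real.Gamma α)
        * ((2 - α - 2 * α ^ 2 + α ^ 3) * Real.Gamma (α - 2)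
              * (Real.log (1 / (β ^ 2 * ρ₀)) - 2 * realDigamma α)
            + Real.pi * (1 / (β ^ 2 * ρ₀)) ^ ((1 + α) / 2)
              * hypergeometricPFQ [1 / 2 + α / 2] [3 / 2, 3 / 2 + α / 2] (-(1 / (4 * β ^ 2 * ρ₀)))
              * (Real.cos (Real.pi * α / 2))⁻¹))

end

/-!
With `c = 1 / (β √ρ₀)` and `x = t ^ 2 / c ^ 2`, the law of the SNR is the image of the Gamma law of
shape `α`, so that the capacity is, up to the factor `1 / (Γ(α) log 2)`, the integral of
`t ^ (α - 1) e ^ (-t) (log (c ^ 2 + t ^ 2) - log (c ^ 2))`. The term with `log (c ^ 2 + t ^ 2)` is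
studied as a function `F` of `c` (`logIntegral`).

* `F` tends to `2 Γ(α) ψ(α)` at `0`, and `F'(c) = 2 c ^ (α - 1) K_α(c)`, where `K_α` is the Laplace
  transform of `s ^ (α - 1) / (1 + s ^ 2)` (`hasDerivAt_logIntegral`, `tendsto_logIntegral_zero`).
* `K_α' = -K_{α + 1}` and `K_{α + 2} + K_α = Γ(α) c ^ (-α)`, so `K_α` solves
  `y'' + y = Γ(α) c ^ (-α)`. The series `p_α = ∑ (-1)ⁿ Γ(α - 2 - 2n) c ^ (2n + 2 - α)` obeys the
  same two rules. For `0 < α < 1` the difference `K_α - p_α` is a combination of `cos` and `sin`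
  whose coefficients are read off at `c = 0` from
  `∫ s ^ (α - 1) / (1 + s ^ 2) = π / (2 sin (π α / 2))`. Applying `-d/dc` carries the formula from
  `α` to `α + 1`, hence to every positive non-integer `α` (`laplaceKernel_eq`).
* Integrating `2 c ^ (α - 1) K_α(c)` termwise from `0` gives `F` (`logIntegral_eq`). The `cos` and
  `sin` parts give the two `₁F₂` and `p_α` gives the `₂F₃`: the terms agree because they have the
  same value at `n = 0` and the same successive ratios.
-/

open Filter Set Topology

/-! ### Generalised power series with an arbitrary real leading exponent -/

/-- The series `∑ aₙ c ^ (2n + μ)` with real leading exponent `μ`, for `c > 0`. -/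
noncomputable def evenSeries (a : ℕ → ℝ) (μ c : ℝ) : ℝ :=
  ∑' n : ℕ, a n * c ^ (2 * (n : ℝ) + μ)

theorem summable_of_ratio_tendsto_zero {a r : ℕ → ℝ} (h : ∀ n, a (n + 1) = a n * r n)
    (hr : Tendsto r atTop (𝓝 0)) : Summable a := by
  refine summable_of_ratio_norm_eventually_le (r := 1 / 2) (by norm_num) ?_
  have : ∀ᶠ n in atTop, ‖r n‖ < 1 / 2 := by
    have := hr.norm
    rw [norm_zero] at this
    exact this.eventually_lt_const (by norm_num)
  filter_upwards [this] with n hn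
  rw [h, norm_mul, mul_comm]
  gcongr

theorem summable_mul_pow_of_ratio {a r : ℕ → ℝ} (h : ∀ n, a (n + 1) = a n * r n)
    (hr : Tendsto r atTop (𝓝 0)) (x : ℝ) : Summable fun n => a n * x ^ n := by
  refine summable_of_ratio_tendsto_zero (r := fun n => r n * x) (fun n => ?_) ?_
  · rw [h, pow_succ]; ring
  · simpa using hr.mul_const x

theorem summable_natCast_mul_mul_pow {a : ℕ → ℝ} (ha : ∀ x : ℝ, Summable fun n => a n * x ^ n)
    (x : ℝ) : Summable fun n : ℕ => (n : ℝ) * a n * x ^ n := by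
  refine Summable.of_norm_bounded (g := fun n => ‖a n * (2 * x) ^ n‖) (ha (2 * x)).norm
    fun n => ?_
  have h2 : (n : ℝ) ≤ 2 ^ n := by exact_mod_cast Nat.lt_two_pow_self.le
  rw [mul_assoc, norm_mul, mul_pow, mul_left_comm, norm_mul (2 ^ n : ℝ)]
  gcongr
  rw [Real.norm_of_nonneg (by positivity), Real.norm_of_nonneg (by positivity)]
  exact h2

theorem hasDerivAt_tsum_mul_pow {a : ℕ → ℝ} (ha : ∀ x : ℝ, Summable fun n => a n * x ^ n)
    (x : ℝ) : HasDerivAt (fun x => ∑' n, a n * x ^ n)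
      (∑' n : ℕ, a n * ((n : ℝ) * x ^ (n - 1))) x := by
  set R : ℝ := |x| + 1
  have hR : 0 < R := by positivity
  refine hasDerivAt_tsum_of_isPreconnected (t := Ioo (-R) R) (y₀ := x)
    (u := fun n : ℕ => R⁻¹ * ‖(n : ℝ) * a n * R ^ n‖) ?_ isOpen_Ioo isPreconnected_Ioo
    (fun n y _ => (hasDerivAt_pow n y).const_mul (a n)) ?_ ?_ (ha x) ?_
  · exact ((summable_natCast_mul_mul_pow ha R).norm).mul_left _
  · intro n y hy
    have hy' : |y| ≤ R := (abs_lt.2 hy).le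
    rcases n with _ | n
    · simp
    · simp only [norm_mul, norm_pow, Real.norm_eq_abs, abs_of_pos hR, Nat.add_sub_cancel]
      have : |y| ^ n ≤ R ^ n := by gcongr
      calc |a (n + 1)| * (|((n + 1 : ℕ) : ℝ)| * |y| ^ n)
          ≤ |a (n + 1)| * (|((n + 1 : ℕ) : ℝ)| * R ^ n) := by gcongr
        _ = _ := by rw [pow_succ]; field_simp
  · exact abs_lt.1 (lt_add_one |x|)
  · exact abs_lt.1 (lt_add_one |x|)

theorem evenSeries_eq_rpow_mul (a : ℕ → ℝ) (μ : ℝ) {c : ℝ} (hc : 0 < c) :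
    evenSeries a μ c = c ^ μ * ∑' n, a n * (c ^ 2) ^ n := by
  rw [evenSeries, ← tsum_mul_left]
  refine tsum_congr fun n => ?_
  rw [Real.rpow_add hc, mul_comm 2 (n : ℝ), Real.rpow_mul hc.le, Real.rpow_natCast, pow_right_comm]
  norm_num
  ring

/-- Termwise differentiation; `a` is the coefficient sequence of an entire power series. -/
theorem hasDerivAt_evenSeries {a : ℕ → ℝ} (ha : ∀ x : ℝ, Summable fun n => a n * x ^ n)
    (μ : ℝ) {c : ℝ} (hc : 0 < c) :
    HasDerivAt (evenSeries a μ)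
      (evenSeries (fun n => (2 * (n : ℝ) + μ) * a n) (μ - 1) c) c := by
  have hg := (hasDerivAt_tsum_mul_pow ha (c ^ 2)).comp c (hasDerivAt_pow 2 c)
  have h1 := (Real.hasDerivAt_rpow_const (p := μ) (Or.inl hc.ne')).mul hg
  refine (h1.congr_of_eventuallyEq ?_).congr_deriv ?_
  · filter_upwards [lt_mem_nhds hc] with y hy
    exact evenSeries_eq_rpow_mul a μ hy
  · rw [evenSeries_eq_rpow_mul _ _ hc]
    have hc2 : c ^ μ = c ^ (μ - 1) * c := by
      rw [← Real.rpow_add_one hc.ne']; ring_nf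
    have e1 : ∑' n : ℕ, (2 * (n : ℝ) + μ) * a n * (c ^ 2) ^ n
        = 2 * ∑' n : ℕ, (n : ℝ) * a n * (c ^ 2) ^ n + μ * ∑' n : ℕ, a n * (c ^ 2) ^ n := by
      rw [← tsum_mul_left, ← tsum_mul_left, ← Summable.tsum_add]
      · exact tsum_congr fun n => by ring
      · exact (summable_natCast_mul_mul_pow ha _).mul_left _
      · exact (ha _).mul_left _
    have e2 : ∑' n : ℕ, (n : ℝ) * a n * (c ^ 2) ^ n
        = c ^ 2 * ∑' n : ℕ, a n * ((n : ℝ) * (c ^ 2) ^ (n - 1)) := by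
      rw [← tsum_mul_left]
      refine tsum_congr fun n => ?_
      rcases n with _ | n
      · simp
      · simp only [Nat.add_sub_cancel]; ring
    rw [e1, e2, hc2]
    simp only [Function.comp]
    push_cast
    ring

theorem tendsto_evenSeries_zero {a : ℕ → ℝ} (ha : ∀ x : ℝ, Summable fun n => a n * x ^ n)
    {μ : ℝ} (hμ : 0 < μ) : Tendsto (evenSeries a μ) (𝓝[>] 0) (𝓝 0) := by
  have h1 : ContinuousAt (fun c : ℝ => c ^ μ * ∑' n, a n * (c ^ 2) ^ n) 0 := by
    refine (Real.continuousAt_rpow_const _ _ (Or.inr hμ.le)).mul ?_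
    exact ((hasDerivAt_tsum_mul_pow ha _).continuousAt).comp
      (f := fun c : ℝ => c ^ 2) (continuous_pow 2).continuousAt
  have h2 := h1.tendsto.mono_left (nhdsWithin_le_nhds (s := Ioi (0 : ℝ)))
  rw [Real.zero_rpow hμ.ne', zero_mul] at h2
  refine h2.congr' ?_
  filter_upwards [self_mem_nhdsWithin] with c hc
  exact (evenSeries_eq_rpow_mul a μ hc).symm

theorem evenSeries_const_mul (k : ℝ) (a : ℕ → ℝ) (μ c : ℝ) :
    evenSeries (fun n => k * a n) μ c = k * evenSeries a μ c := by
  simp only [evenSeries, mul_assoc, tsum_mul_left]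

/-! ### The Laplace transform of `s ^ (α - 1) / (1 + s ^ 2)` -/

/-- The Laplace transform at `c` of `s ↦ s ^ (α - 1) / (1 + s ^ 2)` on `(0, ∞)`. -/
noncomputable def laplaceKernel (α c : ℝ) : ℝ :=
  ∫ s in Ioi (0 : ℝ), s ^ (α - 1) * Real.exp (-(c * s)) / (1 + s ^ 2)

theorem integrableOn_rpow_mul_exp_neg_mul {q c : ℝ} (hq : -1 < q) (hc : 0 < c) :
    IntegrableOn (fun s : ℝ => s ^ q * Real.exp (-(c * s))) (Ioi 0) := by
  simpa using integrableOn_rpow_mul_exp_neg_mul_rpow (p := 1) hq one_pos hc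

theorem integrableOn_laplaceKernel {α c : ℝ} (hα : 0 < α) (hc : 0 < c) :
    IntegrableOn (fun s : ℝ => s ^ (α - 1) * Real.exp (-(c * s)) / (1 + s ^ 2)) (Ioi 0) := by
  refine Integrable.mono' (integrableOn_rpow_mul_exp_neg_mul (q := α - 1) (by linarith) hc)
    (Measurable.aestronglyMeasurable (by fun_prop)) ?_
  filter_upwards [ae_restrict_mem measurableSet_Ioi] with s hs
  have hs : 0 < s := hs
  rw [Real.norm_of_nonneg (by positivity)]
  exact div_le_self (by positivity) (by nlinarith)

theorem hasDerivAt_laplaceKernel {α c : ℝ} (hα : 0 < α) (hc : 0 < c) :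
    HasDerivAt (laplaceKernel α) (-laplaceKernel (α + 1) c) c := by
  have key := hasDerivAt_integral_of_dominated_loc_of_deriv_le
    (μ := volume.restrict (Ioi (0 : ℝ))) (x₀ := c) (s := Ioi (c / 2))
    (F := fun c s : ℝ => s ^ (α - 1) * Real.exp (-(c * s)) / (1 + s ^ 2))
    (F' := fun c s : ℝ => -(s ^ (α + 1 - 1) * Real.exp (-(c * s)) / (1 + s ^ 2)))
    (bound := fun s : ℝ => s ^ α * Real.exp (-(c / 2 * s)))
    (Ioi_mem_nhds (by linarith)) (Eventually.of_forall fun y => Measurable.aestronglyMeasurable (by fun_prop))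
    (integrableOn_laplaceKernel hα hc) (Measurable.aestronglyMeasurable (by fun_prop)) ?_
    (integrableOn_rpow_mul_exp_neg_mul (by linarith) (by linarith)) ?_
  · refine key.2.congr_deriv ?_
    rw [integral_neg]
    rfl
  · filter_upwards [ae_restrict_mem measurableSet_Ioi] with s hs y hy
    have hs : 0 < s := hs
    have hy : c / 2 < y := hy
    rw [norm_neg, Real.norm_of_nonneg (by positivity), add_sub_cancel_right]
    refine (div_le_self (by positivity) (by nlinarith)).trans ?_
    gcongr
  · filter_upwards [ae_restrict_mem measurableSet_Ioi] with s hs y _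
    have hs : 0 < s := hs
    have h1 : HasDerivAt (fun c : ℝ => Real.exp (-(c * s))) (Real.exp (-(y * s)) * -s) y := by
      have : HasDerivAt (fun c : ℝ => -(c * s)) (-s) y := by
        simpa using ((hasDerivAt_id y).mul_const s).fun_neg
      exact this.exp
    refine ((h1.const_mul (s ^ (α - 1))).div_const (1 + s ^ 2)).congr_deriv ?_
    rw [add_sub_cancel_right, show s ^ α = s ^ (α - 1) * s by
      rw [← Real.rpow_add_one hs.ne']; ring_nf]
    ring

/-- Multiplying the integrand by `1 + s ^ 2` leaves Euler's integral for `Γ(α)`. -/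
theorem laplaceKernel_add_two_add {α c : ℝ} (hα : 0 < α) (hc : 0 < c) :
    laplaceKernel (α + 2) c + laplaceKernel α c = Real.Gamma α * c ^ (-α) := by
  have h := Real.integral_rpow_mul_exp_neg_mul_Ioi hα hc
  rw [one_div, Real.inv_rpow hc.le, ← Real.rpow_neg hc.le] at h
  rw [mul_comm, ← h, laplaceKernel, laplaceKernel, ← integral_add
    (integrableOn_laplaceKernel (by linarith) hc) (integrableOn_laplaceKernel hα hc)]
  refine setIntegral_congr_fun measurableSet_Ioi fun s hs => ?_
  have hs : 0 < s := hs
  have e : s ^ (α + 2 - 1) = s ^ (α - 1) * s ^ 2 := by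
    rw [← Real.rpow_natCast s 2, ← Real.rpow_add hs]; norm_num; ring_nf
  simp only [e]
  field_simp
  ring

/-- Obtained by writing `1 / (1 + s ^ 2) = ∫ exp (-(1 + s ^ 2) y) dy` and exchanging the order of
integration, which leaves `Γ(α/2) Γ(1 - α/2) / 2`. -/
theorem integrableOn_and_integral_rpow_div_one_add_sq {α : ℝ} (h0 : 0 < α) (h2 : α < 2) :
    IntegrableOn (fun s : ℝ => s ^ (α - 1) / (1 + s ^ 2)) (Ioi 0) ∧
    ∫ s in Ioi (0 : ℝ), s ^ (α - 1) / (1 + s ^ 2)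
      = Real.pi / (2 * Real.sin (Real.pi * α / 2)) := by
  set ν := volume.restrict (Ioi (0 : ℝ))
  set f : ℝ × ℝ → ℝ := fun z => z.1 ^ (α - 1) * Real.exp (-((1 + z.1 ^ 2) * z.2)) with hf
  have hsplit : ∀ s y : ℝ, f (s, y) = Real.exp (-y) * (s ^ (α - 1) * Real.exp (-y * s ^ (2 : ℝ))) := by
    intro s y
    have : Real.exp (-((1 + s ^ 2) * y)) = Real.exp (-y) * Real.exp (-y * s ^ (2 : ℝ)) := by
      rw [← Real.exp_add, Real.rpow_two]; ring_nf
    simp only [hf, this]; ring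
  have hinner : ∀ y : ℝ, 0 < y → ∫ s in Ioi (0 : ℝ), f (s, y)
      = y ^ ((1 - α / 2) - 1) * Real.exp (-(1 * y)) * (1 / 2 * Real.Gamma (α / 2)) := by
    intro y hy
    simp only [hsplit]
    rw [integral_const_mul, integral_rpow_mul_exp_neg_mul_rpow two_pos (by linarith) hy]
    rw [show -(α - 1 + 1) / 2 = (1 - α / 2) - 1 by ring, show (α - 1 + 1) / 2 = α / 2 by ring]
    ring_nf
  have hmeas : AEStronglyMeasurable f (ν.prod ν) := by
    apply Measurable.aestronglyMeasurable; fun_prop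
  have hint : Integrable f (ν.prod ν) := by
    rw [integrable_prod_iff' hmeas]
    constructor
    · filter_upwards [ae_restrict_mem measurableSet_Ioi] with y hy
      simp only [hsplit]
      exact (integrableOn_rpow_mul_exp_neg_mul_rpow (by linarith) two_pos hy).const_mul _
    · refine ((integrableOn_rpow_mul_exp_neg_mul (q := 1 - α / 2 - 1) (c := 1) (by linarith)
        one_pos).mul_const (1 / 2 * Real.Gamma (α / 2))).congr ?_
      filter_upwards [ae_restrict_mem measurableSet_Ioi] with y hy
      rw [← hinner y hy]
      refine setIntegral_congr_fun measurableSet_Ioi fun s hs => ?_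
      have hs : 0 < s := hs
      exact (Real.norm_of_nonneg (by simp only [hf]; positivity)).symm
  have houter : ∀ s ∈ Ioi (0 : ℝ), ∫ y in Ioi (0 : ℝ), f (s, y) = s ^ (α - 1) / (1 + s ^ 2) := by
    intro s hs
    have h := Real.integral_rpow_mul_exp_neg_mul_Ioi one_pos (r := 1 + s ^ 2) (by positivity)
    simp only [sub_self, Real.rpow_zero, one_mul, Real.rpow_one, Real.Gamma_one, mul_one] at h
    simp only [hf]
    rw [integral_const_mul, h]
    ring
  constructor
  · refine (hint.integral_prod_left).congr ?_
    filter_upwards [ae_restrict_mem measurableSet_Ioi] with s hs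
    exact houter s hs
  · rw [← setIntegral_congr_fun measurableSet_Ioi houter]
    rw [integral_integral_swap (f := fun s y => f (s, y)) hint,
      setIntegral_congr_fun measurableSet_Ioi hinner, integral_mul_const,
      Real.integral_rpow_mul_exp_neg_mul_Ioi (by linarith) one_pos]
    have := Real.Gamma_mul_Gamma_one_sub (α / 2)
    rw [mul_div_assoc]
    simp only [div_one, Real.one_rpow, one_mul]
    rw [mul_left_comm, mul_comm (Real.Gamma (1 - α / 2)), this]
    field_simp

theorem tendsto_laplaceKernel_zero {α : ℝ} (h0 : 0 < α) (h2 : α < 2) :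
    Tendsto (laplaceKernel α) (𝓝[>] 0) (𝓝 (Real.pi / (2 * Real.sin (Real.pi * α / 2)))) := by
  obtain ⟨hi, hv⟩ := integrableOn_and_integral_rpow_div_one_add_sq h0 h2
  rw [← hv]
  refine tendsto_integral_filter_of_dominated_convergence _
    (Eventually.of_forall fun c => Measurable.aestronglyMeasurable (by fun_prop)) ?_ hi ?_
  · filter_upwards [self_mem_nhdsWithin] with c hc
    filter_upwards [ae_restrict_mem measurableSet_Ioi] with s hs
    have hs : 0 < s := hs
    have hc : 0 < c := hc
    rw [Real.norm_of_nonneg (by positivity)]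
    gcongr
    refine mul_le_of_le_one_right (by positivity) (Real.exp_le_one_iff.2 ?_)
    have := mul_pos hc hs
    linarith
  · refine Eventually.of_forall fun s => ?_
    have : Continuous fun c : ℝ => s ^ (α - 1) * Real.exp (-(c * s)) / (1 + s ^ 2) := by fun_prop
    simpa using (this.tendsto 0).mono_left (nhdsWithin_le_nhds (s := Ioi 0))

/-! ### The Gamma-coefficient series -/

/-- The coefficients `(-1)ⁿ Γ(α - 2 - 2n)`. The series with these coefficients and leading exponent
`2 - α` is a particular solution of `y'' + y = Γ(α) c ^ (-α)`. -/
noncomputable def gammaCoeff (α : ℝ) (n : ℕ) : ℝ :=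
  (-1) ^ n * Real.Gamma (α - 2 - 2 * n)

theorem gammaCoeff_succ {α : ℝ} (hα : ∀ n : ℕ, α ≠ n) (n : ℕ) :
    gammaCoeff α (n + 1)
      = gammaCoeff α n * -((2 * (n : ℝ) + (3 - α)) * (2 * (n : ℝ) + (4 - α)))⁻¹ := by
  have h3 : 2 * (n : ℝ) + (3 - α) ≠ 0 := fun h => hα (2 * n + 3) (by push_cast; linarith)
  have h4 : 2 * (n : ℝ) + (4 - α) ≠ 0 := fun h => hα (2 * n + 4) (by push_cast; linarith)
  have e1 := Real.Gamma_add_one (s := α - 4 - 2 * n) fun h => h4 (by linarith)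
  have e2 := Real.Gamma_add_one (s := α - 3 - 2 * n) fun h => h3 (by linarith)
  rw [show α - 4 - 2 * (n : ℝ) + 1 = α - 3 - 2 * n by ring] at e1
  rw [show α - 3 - 2 * (n : ℝ) + 1 = α - 2 - 2 * n by ring, e1] at e2
  simp only [gammaCoeff, e2]
  rw [show α - 2 - 2 * ((n + 1 : ℕ) : ℝ) = α - 4 - 2 * n by push_cast; ring, pow_succ]
  field_simp
  ring

theorem summable_gammaCoeff_mul_pow {α : ℝ} (hα : ∀ n : ℕ, α ≠ n) (x : ℝ) :
    Summable fun n => gammaCoeff α n * x ^ n := by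
  refine summable_mul_pow_of_ratio (gammaCoeff_succ hα) ?_ x
  have h (k : ℝ) : Tendsto (fun n : ℕ => 2 * (n : ℝ) + k) atTop atTop :=
    tendsto_atTop_add_const_right _ _ (tendsto_natCast_atTop_atTop.const_mul_atTop two_pos)
  simpa using (tendsto_inv_atTop_zero.comp ((h (3 - α)).atTop_mul_atTop₀ (h (4 - α)))).neg

theorem hasDerivAt_evenSeries_gammaCoeff {α c : ℝ} (hα : ∀ n : ℕ, α ≠ n) (hc : 0 < c) :
    HasDerivAt (evenSeries (gammaCoeff α) (2 - α))
      (-evenSeries (gammaCoeff (α + 1)) (2 - (α + 1)) c) c := by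
  refine (hasDerivAt_evenSeries (summable_gammaCoeff_mul_pow hα) (2 - α) hc).congr_deriv ?_
  rw [← neg_one_mul, ← evenSeries_const_mul, show 2 - (α + 1) = 2 - α - 1 by ring]
  congr 1
  funext n
  have h2 : α - 2 - 2 * (n : ℝ) ≠ 0 := fun h => hα (2 * n + 2) (by push_cast; linarith)
  have e := Real.Gamma_add_one h2
  rw [gammaCoeff, gammaCoeff, show α + 1 - 2 - 2 * (n : ℝ) = α - 2 - 2 * n + 1 by ring, e]
  ring

theorem ne_natCast_add_one {α : ℝ} (h0 : 0 < α) (hα : ∀ n : ℕ, α ≠ n) (n : ℕ) : α + 1 ≠ n := by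
  rcases n with _ | n
  · push_cast; linarith
  · have := hα n
    push_cast
    intro h
    exact this (by linarith)

/-- The same rule as `laplaceKernel_add_two_add`: the `n`-th terms for `α` cancel the terms of index
`n + 1` for `α + 2`, and the term of index `0` remains. -/
theorem evenSeries_gammaCoeff_add_two_add {α c : ℝ} (h0 : 0 < α) (hα : ∀ n : ℕ, α ≠ n)
    (hc : 0 < c) :
    evenSeries (gammaCoeff (α + 2)) (2 - (α + 2)) c + evenSeries (gammaCoeff α) (2 - α) c
      = Real.Gamma α * c ^ (-α) := by
  have hα2 : ∀ n : ℕ, α + 2 ≠ n := fun n => by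
    have := ne_natCast_add_one (by linarith) (ne_natCast_add_one h0 hα) n
    rwa [add_assoc, one_add_one_eq_two] at this
  have hs := summable_gammaCoeff_mul_pow hα2 (c ^ 2)
  rw [evenSeries_eq_rpow_mul _ _ hc, evenSeries_eq_rpow_mul _ _ hc, hs.tsum_eq_zero_add]
  have e : ∑' n, gammaCoeff (α + 2) (n + 1) * (c ^ 2) ^ (n + 1)
      = -c ^ 2 * ∑' n, gammaCoeff α n * (c ^ 2) ^ n := by
    rw [← tsum_mul_left]
    refine tsum_congr fun n => ?_
    rw [gammaCoeff, gammaCoeff,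
      show α + 2 - 2 - 2 * ((n + 1 : ℕ) : ℝ) = α - 2 - 2 * n by push_cast; ring]
    ring
  have e2 : c ^ (2 - α) = c ^ (-α) * c ^ 2 := by
    rw [← Real.rpow_natCast c 2, ← Real.rpow_add hc]; norm_num; ring_nf
  rw [e, e2, show 2 - (α + 2) = -α by ring]
  simp [gammaCoeff]
  ring

/-! ### Closed form of the Laplace transform -/

theorem eq_of_hasDerivAt_of_tendsto_zero {f g f' : ℝ → ℝ} {L : ℝ}
    (hf : ∀ c, 0 < c → HasDerivAt f (f' c) c) (hg : ∀ c, 0 < c → HasDerivAt g (f' c) c)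
    (hf0 : Tendsto f (𝓝[>] 0) (𝓝 L)) (hg0 : Tendsto g (𝓝[>] 0) (𝓝 L)) {c : ℝ} (hc : 0 < c) :
    f c = g c := by
  have hd : ∀ x ∈ Ioi (0 : ℝ), HasDerivAt (fun y => f y - g y) 0 x := fun x hx => by
    simpa using (hf x hx).fun_sub (hg x hx)
  obtain ⟨a, ha⟩ := isOpen_Ioi.exists_is_const_of_deriv_eq_zero (isPreconnected_Ioi (a := (0 : ℝ)))
    (fun x hx => (hd x hx).differentiableAt.differentiableWithinAt)
    (fun x hx => (hd x hx).deriv)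
  have h1 : Tendsto (fun y => f y - g y) (𝓝[>] 0) (𝓝 a) :=
    tendsto_const_nhds.congr' (by filter_upwards [self_mem_nhdsWithin] with y hy using (ha y hy).symm)
  have h2 : Tendsto (fun y => f y - g y) (𝓝[>] 0) (𝓝 0) := by simpa using hf0.sub hg0
  have := ha c hc
  rw [tendsto_nhds_unique h1 h2] at this
  linarith

theorem sin_pi_mul_add_one_div_two (α : ℝ) :
    Real.sin (Real.pi * (α + 1) / 2) = Real.cos (Real.pi * α / 2) := by
  rw [← Real.sin_add_pi_div_two]; ring_nf

theorem cos_pi_mul_add_one_div_two (α : ℝ) :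
    Real.cos (Real.pi * (α + 1) / 2) = -Real.sin (Real.pi * α / 2) := by
  rw [← Real.cos_add_pi_div_two]; ring_nf

/-- For `0 < α < 1` the difference `h` of the Laplace transform and the particular solution solves
`h'' + h = 0` on `(0, ∞)`, and both `h` and `h'` have limits at `0`. -/
theorem laplaceKernel_eq_of_lt_one {α : ℝ} (h0 : 0 < α) (h1 : α < 1) {c : ℝ} (hc : 0 < c) :
    laplaceKernel α c = Real.pi / (2 * Real.sin (Real.pi * α / 2)) * Real.cos c
      - Real.pi / (2 * Real.cos (Real.pi * α / 2)) * Real.sin c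
      + evenSeries (gammaCoeff α) (2 - α) c := by
  have hα : ∀ n : ℕ, α ≠ n := fun n h => by
    rw [h] at h0 h1
    have h0 : 0 < n := by exact_mod_cast h0
    have h1 : n < 1 := by exact_mod_cast h1
    omega
  have hα1 := ne_natCast_add_one h0 hα
  set h : ℝ → ℝ := fun c => laplaceKernel α c - evenSeries (gammaCoeff α) (2 - α) c with hh
  set k : ℝ → ℝ := fun c =>
    laplaceKernel (α + 1) c - evenSeries (gammaCoeff (α + 1)) (2 - (α + 1)) c with hk
  have dh : ∀ c, 0 < c → HasDerivAt h (-k c) c := fun c hc =>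
    ((hasDerivAt_laplaceKernel h0 hc).fun_sub (hasDerivAt_evenSeries_gammaCoeff hα hc)).congr_deriv
      (by simp only [hk]; ring)
  have dk : ∀ c, 0 < c → HasDerivAt k (h c) c := fun c hc =>
    ((hasDerivAt_laplaceKernel (by linarith) hc).fun_sub
      (hasDerivAt_evenSeries_gammaCoeff hα1 hc)).congr_deriv (by
        have e1 := laplaceKernel_add_two_add h0 hc
        have e2 := evenSeries_gammaCoeff_add_two_add h0 hα hc
        rw [show α + 1 + 1 = α + 2 by ring]
        simp only [hh]
        linarith)
  have lh : Tendsto h (𝓝[>] 0) (𝓝 (Real.pi / (2 * Real.sin (Real.pi * α / 2)))) := by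
    simpa using (tendsto_laplaceKernel_zero h0 (by linarith)).sub
      (tendsto_evenSeries_zero (summable_gammaCoeff_mul_pow hα) (μ := 2 - α) (by linarith))
  have lk : Tendsto k (𝓝[>] 0) (𝓝 (Real.pi / (2 * Real.cos (Real.pi * α / 2)))) := by
    simpa [sin_pi_mul_add_one_div_two] using
      (tendsto_laplaceKernel_zero (α := α + 1) (by linarith) (by linarith)).sub
      (tendsto_evenSeries_zero (summable_gammaCoeff_mul_pow hα1) (μ := 2 - (α + 1)) (by linarith))
  have lcos : Tendsto Real.cos (𝓝[>] 0) (𝓝 1) := by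
    simpa using (Real.continuous_cos.tendsto 0).mono_left (nhdsWithin_le_nhds (s := Ioi 0))
  have lsin : Tendsto Real.sin (𝓝[>] 0) (𝓝 0) := by
    simpa using (Real.continuous_sin.tendsto 0).mono_left (nhdsWithin_le_nhds (s := Ioi 0))
  -- The first integrals `h cos + k sin` and `h sin - k cos` are constant.
  have u := eq_of_hasDerivAt_of_tendsto_zero (f' := fun _ => 0)
    (f := fun c => h c * Real.cos c + k c * Real.sin c)
    (g := fun _ => Real.pi / (2 * Real.sin (Real.pi * α / 2)))
    (fun c hc => (((dh c hc).fun_mul (Real.hasDerivAt_cos c)).fun_add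
      ((dk c hc).fun_mul (Real.hasDerivAt_sin c))).congr_deriv (by ring))
    (fun c _ => hasDerivAt_const c _)
    (by simpa using (lh.mul lcos).add (lk.mul lsin)) tendsto_const_nhds hc
  have v := eq_of_hasDerivAt_of_tendsto_zero (f' := fun _ => 0)
    (f := fun c => h c * Real.sin c - k c * Real.cos c)
    (g := fun _ => -(Real.pi / (2 * Real.cos (Real.pi * α / 2))))
    (fun c hc => (((dh c hc).fun_mul (Real.hasDerivAt_sin c)).fun_sub
      ((dk c hc).fun_mul (Real.hasDerivAt_cos c))).congr_deriv (by ring))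
    (fun c _ => hasDerivAt_const c _)
    (by simpa using (lh.mul lsin).sub (lk.mul lcos)) tendsto_const_nhds hc
  have : h c = (h c * Real.cos c + k c * Real.sin c) * Real.cos c
      + (h c * Real.sin c - k c * Real.cos c) * Real.sin c := by
    linear_combination h c * (-Real.sin_sq_add_cos_sq c)
  rw [u, v] at this
  simp only [hh] at this
  linarith

/-- Both sides turn into those for `α + 1` under `-d/dc`, which reduces the claim to
`0 < α < 1`. -/
theorem laplaceKernel_eq {α : ℝ} (h0 : 0 < α) (hα : ∀ n : ℕ, α ≠ n) {c : ℝ} (hc : 0 < c) :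
    laplaceKernel α c = Real.pi / (2 * Real.sin (Real.pi * α / 2)) * Real.cos c
      - Real.pi / (2 * Real.cos (Real.pi * α / 2)) * Real.sin c
      + evenSeries (gammaCoeff α) (2 - α) c := by
  have step : ∀ (m : ℕ) (α : ℝ), 0 < α → (∀ n : ℕ, α ≠ n) → α < m + 1 → ∀ c, 0 < c →
      laplaceKernel α c = Real.pi / (2 * Real.sin (Real.pi * α / 2)) * Real.cos c
        - Real.pi / (2 * Real.cos (Real.pi * α / 2)) * Real.sin c
        + evenSeries (gammaCoeff α) (2 - α) c := by
    intro m
    induction m with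
    | zero => exact fun α h0 _ h1 c hc => laplaceKernel_eq_of_lt_one h0 (by simpa using h1) hc
    | succ m ih =>
      intro γ h0 hγ hm c hc
      rcases lt_trichotomy γ 1 with h1 | h1 | h1
      · exact laplaceKernel_eq_of_lt_one h0 h1 hc
      · exact absurd h1 (by simpa using hγ 1)
      obtain ⟨α, rfl⟩ : ∃ α, γ = α + 1 := ⟨γ - 1, by ring⟩
      have hα0 : 0 < α := by linarith
      have hα : ∀ n : ℕ, α ≠ n := fun n h => hγ (n + 1) (by rw [h]; push_cast; ring)
      have ih' := ih α hα0 hα (by push_cast at hm; linarith)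
      have d1 := hasDerivAt_laplaceKernel hα0 hc
      have d2 := (((Real.hasDerivAt_cos c).const_mul
        (Real.pi / (2 * Real.sin (Real.pi * α / 2)))).fun_sub ((Real.hasDerivAt_sin c).const_mul
        (Real.pi / (2 * Real.cos (Real.pi * α / 2))))).fun_add
        (hasDerivAt_evenSeries_gammaCoeff hα hc)
      have d3 := d2.congr_of_eventuallyEq (f₁ := laplaceKernel α) (by
        filter_upwards [lt_mem_nhds hc] with y hy using ih' y hy)
      have := d1.unique d3
      rw [sin_pi_mul_add_one_div_two, cos_pi_mul_add_one_div_two, mul_neg, div_neg]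
      linarith
  obtain ⟨m, hm⟩ := exists_nat_gt α
  exact step m α h0 hα (by linarith) c hc

/-! ### The logarithmic integral -/

theorem integrableOn_rpow_mul_exp_neg_mul_log {α : ℝ} (h0 : 0 < α) :
    IntegrableOn (fun t : ℝ => t ^ (α - 1) * Real.exp (-t) * Real.log t) (Ioi 0) := by
  have h := (mellin_hasDerivAt_of_isBigO_rpow (E := ℂ) (s := (α : ℂ)) (a := α + 1) (b := 0)
    (f := fun t : ℝ => (Real.exp (-t) : ℂ)) ?_ ?_ (by simp) ?_ (by simpa using h0)).1
  · have h' := h.re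
    refine h'.congr ?_
    filter_upwards [ae_restrict_mem measurableSet_Ioi] with t ht
    have ht : 0 < t := ht
    have : (t : ℂ) ^ ((α : ℂ) - 1) = ((t ^ (α - 1) : ℝ) : ℂ) := by
      rw [Complex.ofReal_cpow ht.le]; push_cast; rfl
    rw [this]
    simp only [smul_eq_mul, Complex.real_smul, ← Complex.ofReal_mul, RCLike.re_to_complex,
      Complex.ofReal_re]
    ring
  · refine (Continuous.continuousOn ?_).locallyIntegrableOn measurableSet_Ioi
    fun_prop
  · rw [← Asymptotics.isBigO_norm_left]
    simp_rw [Complex.norm_real, Asymptotics.isBigO_norm_left]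
    simpa only [neg_one_mul] using (isLittleO_exp_neg_mul_rpow_atTop zero_lt_one _).isBigO
  · simp_rw [neg_zero, Real.rpow_zero]
    refine Asymptotics.isBigO_const_of_tendsto (?_ : Tendsto _ _ (𝓝 (1 : ℂ))) one_ne_zero
    have : Continuous fun t : ℝ => (Real.exp (-t) : ℂ) := by fun_prop
    simpa using (this.tendsto 0).mono_left (nhdsWithin_le_nhds (s := Ioi 0))

/-- The derivative of Euler's integral, as a formula for the digamma function. -/
theorem integral_rpow_mul_exp_neg_mul_log {α : ℝ} (h0 : 0 < α) :
    ∫ t in Ioi (0 : ℝ), t ^ (α - 1) * Real.exp (-t) * Real.log t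
      = Real.Gamma α * realDigamma α := by
  have hd : HasDerivAt Complex.Gamma _ (α : ℂ) :=
    (Complex.hasDerivAt_GammaIntegral (s := (α : ℂ)) (by simpa using h0)).congr_of_eventuallyEq (by
      have : {s : ℂ | 0 < s.re} ∈ 𝓝 (α : ℂ) :=
        (isOpen_lt continuous_const Complex.continuous_re).mem_nhds (by simpa using h0)
      filter_upwards [this] with s hs using Complex.Gamma_eq_integral hs)
  have e : ∫ t : ℝ in Ioi 0, (t : ℂ) ^ ((α : ℂ) - 1) * (Real.log t * Real.exp (-t))
      = ((∫ t in Ioi (0 : ℝ), t ^ (α - 1) * Real.exp (-t) * Real.log t : ℝ) : ℂ) := by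
    rw [← integral_complex_ofReal]
    refine setIntegral_congr_fun measurableSet_Ioi fun t ht => ?_
    have ht : 0 < t := ht
    have : (t : ℂ) ^ ((α : ℂ) - 1) = ((t ^ (α - 1) : ℝ) : ℂ) := by
      rw [Complex.ofReal_cpow ht.le]; push_cast; rfl
    simp only [this]
    push_cast
    ring
  rw [realDigamma, Complex.digamma_def, logDeriv_apply, hd.deriv, e, Complex.Gamma_ofReal,
    ← Complex.ofReal_div, Complex.ofReal_re, mul_div_cancel₀ _ (Real.Gamma_pos_of_pos h0).ne']

/-- The integral of `t ^ (α - 1) e ^ (-t) log (c ^ 2 + t ^ 2)` over `(0, ∞)`. -/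
noncomputable def logIntegral (α c : ℝ) : ℝ :=
  ∫ t in Ioi (0 : ℝ), t ^ (α - 1) * Real.exp (-t) * Real.log (c ^ 2 + t ^ 2)

theorem abs_log_sq_add_sq_le {c t : ℝ} (ht : 0 < t) :
    |Real.log (c ^ 2 + t ^ 2)| ≤ 2 * |Real.log t| + (c ^ 2 + t ^ 2) := by
  have h1 : Real.log (t ^ 2) ≤ Real.log (c ^ 2 + t ^ 2) :=
    Real.log_le_log (by positivity) (by nlinarith)
  have h2 : Real.log (c ^ 2 + t ^ 2) ≤ c ^ 2 + t ^ 2 := Real.log_le_self (by positivity)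
  rw [Real.log_pow] at h1
  push_cast at h1
  have h3 := neg_abs_le (Real.log t)
  have h4 := abs_nonneg (Real.log t)
  rw [abs_le]
  constructor
  · nlinarith [sq_nonneg c, sq_nonneg t]
  · linarith

/-- The dominating function that serves for all `c` in a bounded interval, up to `c = 0`. -/
theorem integrableOn_logIntegral_bound {α : ℝ} (h0 : 0 < α) (c : ℝ) :
    IntegrableOn (fun t : ℝ => t ^ (α - 1) * Real.exp (-t) *
      (2 * |Real.log t| + (c ^ 2 + t ^ 2))) (Ioi 0) := by
  have h1 := (integrableOn_rpow_mul_exp_neg_mul_log h0).norm.const_mul 2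
  have h2 := (integrableOn_rpow_mul_exp_neg_mul (q := α - 1) (by linarith) one_pos).const_mul (c ^ 2)
  have h3 := integrableOn_rpow_mul_exp_neg_mul (q := α + 1) (by linarith) one_pos
  refine ((h1.add h2).add h3).congr ?_
  filter_upwards [ae_restrict_mem measurableSet_Ioi] with t ht
  have ht : 0 < t := ht
  have e : t ^ (α + 1) = t ^ (α - 1) * t ^ 2 := by
    rw [← Real.rpow_natCast t 2, ← Real.rpow_add ht]; norm_num; ring_nf
  simp only [Pi.add_apply, norm_mul, Real.norm_eq_abs, abs_of_pos (Real.rpow_pos_of_pos ht _),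
    Real.abs_exp, one_mul, e]
  ring

theorem integrableOn_logIntegral {α : ℝ} (h0 : 0 < α) (c : ℝ) :
    IntegrableOn (fun t : ℝ => t ^ (α - 1) * Real.exp (-t) * Real.log (c ^ 2 + t ^ 2))
      (Ioi 0) := by
  refine Integrable.mono' (integrableOn_logIntegral_bound h0 c)
    (Measurable.aestronglyMeasurable (by fun_prop)) ?_
  filter_upwards [ae_restrict_mem measurableSet_Ioi] with t ht
  have ht : 0 < t := ht
  rw [norm_mul, Real.norm_of_nonneg (by positivity)]
  gcongr
  exact abs_log_sq_add_sq_le ht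

theorem hasDerivAt_logIntegral {α c : ℝ} (h0 : 0 < α) (hc : 0 < c) :
    HasDerivAt (logIntegral α) (2 * c ^ (α - 1) * laplaceKernel α c) c := by
  have key := hasDerivAt_integral_of_dominated_loc_of_deriv_le
    (μ := volume.restrict (Ioi (0 : ℝ))) (x₀ := c) (s := Ioi (c / 2))
    (F := fun c t : ℝ => t ^ (α - 1) * Real.exp (-t) * Real.log (c ^ 2 + t ^ 2))
    (F' := fun c t : ℝ => t ^ (α - 1) * Real.exp (-t) * (2 * c / (c ^ 2 + t ^ 2)))
    (bound := fun t : ℝ => t ^ (α - 1) * Real.exp (-(1 * t)) * (4 / c))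
    (Ioi_mem_nhds (by linarith))
    (Eventually.of_forall fun y => Measurable.aestronglyMeasurable (by fun_prop))
    (integrableOn_logIntegral h0 c) (Measurable.aestronglyMeasurable (by fun_prop)) ?_
    ((integrableOn_rpow_mul_exp_neg_mul (by linarith) one_pos).mul_const _) ?_
  · refine key.2.congr_deriv ?_
    have h := integral_comp_mul_left_Ioi
      (fun t : ℝ => t ^ (α - 1) * Real.exp (-t) * (2 * c / (c ^ 2 + t ^ 2))) 0 hc
    rw [mul_zero, smul_eq_mul, eq_inv_mul_iff_mul_eq₀ hc.ne'] at h
    rw [← h, laplaceKernel, ← integral_const_mul, ← integral_const_mul]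
    refine setIntegral_congr_fun measurableSet_Ioi fun s hs => ?_
    have hs : 0 < s := hs
    simp only [Real.mul_rpow hc.le hs.le, mul_pow]
    field_simp
  · filter_upwards [ae_restrict_mem measurableSet_Ioi] with t ht y hy
    have ht : 0 < t := ht
    have hy : c / 2 < y := hy
    have hy0 : 0 < y := by linarith
    rw [Real.norm_of_nonneg (by positivity), one_mul]
    refine mul_le_mul_of_nonneg_left ?_ (by positivity)
    -- `2 y / (y ^ 2 + t ^ 2) ≤ 2 / y ≤ 4 / c`, since `y > c / 2`
    rw [div_le_div_iff₀ (by positivity) hc]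
    nlinarith [sq_nonneg t]
  · filter_upwards [ae_restrict_mem measurableSet_Ioi] with t ht y _
    have ht : 0 < t := ht
    have h1 : HasDerivAt (fun c : ℝ => c ^ 2 + t ^ 2) (2 * y) y := by
      simpa using (hasDerivAt_pow 2 y).add_const (t ^ 2)
    exact (h1.log (by positivity)).const_mul _

theorem tendsto_logIntegral_zero {α : ℝ} (h0 : 0 < α) :
    Tendsto (logIntegral α) (𝓝[>] 0) (𝓝 (2 * (Real.Gamma α * realDigamma α))) := by
  rw [← integral_rpow_mul_exp_neg_mul_log h0, ← integral_const_mul]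
  refine tendsto_integral_filter_of_dominated_convergence _
    (Eventually.of_forall fun c => Measurable.aestronglyMeasurable (by fun_prop)) ?_
    (integrableOn_logIntegral_bound h0 1) ?_
  · filter_upwards [Ioo_mem_nhdsGT one_pos] with c hc
    filter_upwards [ae_restrict_mem measurableSet_Ioi] with t ht
    have ht : 0 < t := ht
    rw [norm_mul, Real.norm_of_nonneg (by positivity)]
    gcongr
    refine (abs_log_sq_add_sq_le ht).trans ?_
    have : c ^ 2 ≤ 1 ^ 2 := pow_le_pow_left₀ hc.1.le hc.2.le 2
    linarith
  · filter_upwards [ae_restrict_mem measurableSet_Ioi] with t ht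
    have ht : 0 < t := ht
    have h1 : ContinuousAt (fun c : ℝ => t ^ (α - 1) * Real.exp (-t) * Real.log (c ^ 2 + t ^ 2))
        0 := by
      refine continuousAt_const.mul (ContinuousAt.log (by fun_prop) (by positivity))
    have h2 := h1.tendsto.mono_left (nhdsWithin_le_nhds (s := Ioi (0 : ℝ)))
    simp only [ne_eq, OfNat.ofNat_ne_zero, not_false_eq_true, zero_pow, zero_add,
      Real.log_pow] at h2
    convert! h2 using 2
    push_cast
    ring

/-! ### Termwise integration -/

/-- The coefficients `(-1)ⁿ / ((2n)! (2n + α))` of the primitive of `c ^ (α - 1) cos c`. -/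
noncomputable def cosCoeff (α : ℝ) (n : ℕ) : ℝ :=
  (-1) ^ n / ((2 * n).factorial * (2 * (n : ℝ) + α))

/-- The coefficients `(-1)ⁿ / ((2n + 1)! (2n + 1 + α))` of the primitive of `c ^ (α - 1) sin c`. -/
noncomputable def sinCoeff (α : ℝ) (n : ℕ) : ℝ :=
  (-1) ^ n / ((2 * n + 1).factorial * (2 * (n : ℝ) + (1 + α)))

theorem summable_mul_pow_of_abs_le {a : ℕ → ℝ} {C : ℝ}
    (h : ∀ n, |a n| ≤ C / n.factorial) (x : ℝ) : Summable fun n => a n * x ^ n := by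
  refine Summable.of_norm_bounded (g := fun n => C * (|x| ^ n / n.factorial))
    ((Real.summable_pow_div_factorial |x|).mul_left C) fun n => ?_
  rw [norm_mul, norm_pow, Real.norm_eq_abs, Real.norm_eq_abs, mul_div_left_comm, mul_comm]
  exact mul_le_mul_of_nonneg_left (h n) (by positivity)

theorem abs_neg_one_pow_div_factorial_le {μ : ℝ} (hμ : 0 < μ) {m n : ℕ} (h : n ≤ m) :
    |(-1) ^ n / (m.factorial * (2 * (n : ℝ) + μ))| ≤ 1 / μ / n.factorial := by
  rw [abs_div, abs_pow, abs_neg, abs_one, one_pow, div_div, mul_comm,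
    abs_of_pos (by positivity)]
  have : (n.factorial : ℝ) ≤ m.factorial := by exact_mod_cast Nat.factorial_le h
  gcongr
  have : (0 : ℝ) ≤ n := by positivity
  linarith

theorem summable_cosCoeff_mul_pow {α : ℝ} (h0 : 0 < α) (x : ℝ) :
    Summable fun n => cosCoeff α n * x ^ n :=
  summable_mul_pow_of_abs_le (fun n => abs_neg_one_pow_div_factorial_le h0 (by omega)) x

theorem summable_sinCoeff_mul_pow {α : ℝ} (h0 : 0 < α) (x : ℝ) :
    Summable fun n => sinCoeff α n * x ^ n :=
  summable_mul_pow_of_abs_le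
    (fun n => abs_neg_one_pow_div_factorial_le (μ := 1 + α) (by linarith) (by omega)) x

theorem summable_gammaCoeff_div_mul_pow {α : ℝ} (hα : ∀ n : ℕ, α ≠ n) (x : ℝ) :
    Summable fun n : ℕ => gammaCoeff α n / (2 * (n : ℝ) + 2) * x ^ n := by
  refine Summable.of_norm_bounded (summable_gammaCoeff_mul_pow hα x).norm fun n => ?_
  rw [norm_mul, norm_mul, norm_div]
  gcongr
  refine div_le_self (norm_nonneg _) ?_
  rw [Real.norm_of_nonneg (by positivity)]
  have : (0 : ℝ) ≤ n := by positivity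
  linarith

theorem hasDerivAt_evenSeries_cosCoeff {α c : ℝ} (h0 : 0 < α) (hc : 0 < c) :
    HasDerivAt (evenSeries (cosCoeff α) α) (c ^ (α - 1) * Real.cos c) c := by
  refine (hasDerivAt_evenSeries (summable_cosCoeff_mul_pow h0) α hc).congr_deriv ?_
  rw [evenSeries_eq_rpow_mul _ _ hc, ← (Real.hasSum_cos c).tsum_eq]
  congr 1
  refine tsum_congr fun n => ?_
  have : 2 * (n : ℝ) + α ≠ 0 := by positivity
  rw [cosCoeff, pow_mul]
  field_simp

theorem hasDerivAt_evenSeries_sinCoeff {α c : ℝ} (h0 : 0 < α) (hc : 0 < c) :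
    HasDerivAt (evenSeries (sinCoeff α) (1 + α)) (c ^ (α - 1) * Real.sin c) c := by
  refine (hasDerivAt_evenSeries (summable_sinCoeff_mul_pow h0) (1 + α) hc).congr_deriv ?_
  rw [evenSeries_eq_rpow_mul _ _ hc, ← (Real.hasSum_sin c).tsum_eq,
    show c ^ (1 + α - 1) = c ^ (α - 1) * c by rw [← Real.rpow_add_one hc.ne']; ring_nf,
    mul_assoc, ← tsum_mul_left]
  congr 1
  refine tsum_congr fun n => ?_
  have : 2 * (n : ℝ) + (1 + α) ≠ 0 := by positivity
  rw [sinCoeff, pow_succ c (2 * n), pow_mul]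
  field_simp

theorem hasDerivAt_evenSeries_gammaCoeff_div {α c : ℝ} (hα : ∀ n : ℕ, α ≠ n) (hc : 0 < c) :
    HasDerivAt (evenSeries (fun n => gammaCoeff α n / (2 * (n : ℝ) + 2)) 2)
      (c ^ (α - 1) * evenSeries (gammaCoeff α) (2 - α) c) c := by
  refine (hasDerivAt_evenSeries (summable_gammaCoeff_div_mul_pow hα) 2 hc).congr_deriv ?_
  rw [evenSeries_eq_rpow_mul _ _ hc, evenSeries_eq_rpow_mul _ _ hc, ← mul_assoc,
    ← Real.rpow_add hc]
  congr 1
  · ring_nf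
  · refine tsum_congr fun n => ?_
    field_simp

theorem logIntegral_eq {α : ℝ} (h0 : 0 < α) (hα : ∀ n : ℕ, α ≠ n) {c : ℝ} (hc : 0 < c) :
    logIntegral α c = 2 * (Real.Gamma α * realDigamma α)
      + Real.pi / Real.sin (Real.pi * α / 2) * evenSeries (cosCoeff α) α c
      - Real.pi / Real.cos (Real.pi * α / 2) * evenSeries (sinCoeff α) (1 + α) c
      + 2 * evenSeries (fun n => gammaCoeff α n / (2 * (n : ℝ) + 2)) 2 c := by
  refine eq_of_hasDerivAt_of_tendsto_zero (f := logIntegral α)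
    (fun c hc => hasDerivAt_logIntegral h0 hc)
    (fun c hc => ((((hasDerivAt_evenSeries_cosCoeff h0 hc).const_mul _).const_add _).fun_sub
      ((hasDerivAt_evenSeries_sinCoeff h0 hc).const_mul _)).fun_add
      ((hasDerivAt_evenSeries_gammaCoeff_div hα hc).const_mul 2) |>.congr_deriv ?_)
    (tendsto_logIntegral_zero h0) ?_ hc
  · rw [laplaceKernel_eq h0 hα hc, div_mul_eq_div_div_swap, div_mul_eq_div_div_swap]
    ring
  · simpa using ((((tendsto_evenSeries_zero (summable_cosCoeff_mul_pow h0) h0).const_mul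
      (Real.pi / Real.sin (Real.pi * α / 2))).const_add (2 * (Real.Gamma α * realDigamma α))).sub
      ((tendsto_evenSeries_zero (summable_sinCoeff_mul_pow h0) (μ := 1 + α)
        (by linarith)).const_mul (Real.pi / Real.cos (Real.pi * α / 2)))).add
      ((tendsto_evenSeries_zero (summable_gammaCoeff_div_mul_pow hα) two_pos).const_mul 2)

/-! ### Identification of the hypergeometric series -/

theorem hypergeometricTerm_eq_cosCoeff {α : ℝ} (h0 : 0 < α) (x : ℝ) (n : ℕ) :
    hypergeometricTerm [α / 2] [1 / 2, 1 + α / 2] (-(x / 4)) n = α * cosCoeff α n * x ^ n := by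
  induction n with
  | zero => simp [hypergeometricTerm, cosCoeff, h0.ne']
  | succ n ih =>
    have e : hypergeometricTerm [α / 2] [1 / 2, 1 + α / 2] (-(x / 4)) (n + 1)
        = hypergeometricTerm [α / 2] [1 / 2, 1 + α / 2] (-(x / 4)) n
          * ((α / 2 + n) / ((1 / 2 + n) * (1 + α / 2 + n)) * (-(x / 4) / (n + 1))) := by
      simp only [hypergeometricTerm, List.map, List.prod_cons, List.prod_nil,
        ascPochhammer_succ_eval, pow_succ, Nat.factorial_succ]
      push_cast
      simp only [div_eq_mul_inv, mul_inv]
      ring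
    rw [e, ih, cosCoeff, cosCoeff, show 2 * (n + 1) = 2 * n + 1 + 1 by ring,
      Nat.factorial_succ, Nat.factorial_succ]
    push_cast
    field_simp
    ring

theorem hypergeometricTerm_eq_sinCoeff {α : ℝ} (h0 : 0 < α) (x : ℝ) (n : ℕ) :
    hypergeometricTerm [1 / 2 + α / 2] [3 / 2, 3 / 2 + α / 2] (-(x / 4)) n
      = (1 + α) * sinCoeff α n * x ^ n := by
  induction n with
  | zero =>
    have : 1 + α ≠ 0 := by positivity
    simp [hypergeometricTerm, sinCoeff, this]
  | succ n ih =>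
    have e : hypergeometricTerm [1 / 2 + α / 2] [3 / 2, 3 / 2 + α / 2] (-(x / 4)) (n + 1)
        = hypergeometricTerm [1 / 2 + α / 2] [3 / 2, 3 / 2 + α / 2] (-(x / 4)) n
          * ((1 / 2 + α / 2 + n) / ((3 / 2 + n) * (3 / 2 + α / 2 + n)) * (-(x / 4) / (n + 1))) := by
      simp only [hypergeometricTerm, List.map, List.prod_cons, List.prod_nil,
        ascPochhammer_succ_eval, pow_succ, Nat.factorial_succ]
      push_cast
      simp only [div_eq_mul_inv, mul_inv]
      ring
    rw [e, ih, sinCoeff, sinCoeff, show 2 * (n + 1) + 1 = 2 * n + 1 + 1 + 1 by ring,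
      Nat.factorial_succ (2 * n + 1 + 1), Nat.factorial_succ (2 * n + 1)]
    push_cast
    field_simp
    ring

theorem Gamma_sub_two_ne_zero {α : ℝ} (h0 : 0 < α) (hα : ∀ n : ℕ, α ≠ n) :
    Real.Gamma (α - 2) ≠ 0 := by
  refine Real.Gamma_ne_zero fun m h => ?_
  rcases m with _ | _ | m
  · exact hα 2 (by push_cast at *; linarith)
  · exact hα 1 (by push_cast at *; linarith)
  · push_cast at h
    have : (0 : ℝ) ≤ m := by positivity
    linarith

theorem hypergeometricTerm_eq_gammaCoeff {α : ℝ} (h0 : 0 < α) (hα : ∀ n : ℕ, α ≠ n) (x : ℝ)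
    (n : ℕ) :
    hypergeometricTerm [1, 1] [2, 3 / 2 - α / 2, 2 - α / 2] (-(x / 4)) n
      = 2 / Real.Gamma (α - 2) * (gammaCoeff α n / (2 * (n : ℝ) + 2)) * x ^ n := by
  have hG := Gamma_sub_two_ne_zero h0 hα
  induction n with
  | zero => simp [hypergeometricTerm, gammaCoeff, hG]
  | succ n ih =>
    have e : hypergeometricTerm [1, 1] [2, 3 / 2 - α / 2, 2 - α / 2] (-(x / 4)) (n + 1)
        = hypergeometricTerm [1, 1] [2, 3 / 2 - α / 2, 2 - α / 2] (-(x / 4)) n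
          * ((1 + n) * (1 + n) / ((2 + n) * ((3 / 2 - α / 2 + n) * (2 - α / 2 + n)))
            * (-(x / 4) / (n + 1))) := by
      simp only [hypergeometricTerm, List.map, List.prod_cons, List.prod_nil,
        ascPochhammer_succ_eval, pow_succ, Nat.factorial_succ]
      push_cast
      simp only [div_eq_mul_inv, mul_inv]
      ring
    have h3 : 2 * (n : ℝ) + (3 - α) ≠ 0 := fun h => hα (2 * n + 3) (by push_cast; linarith)
    have h4 : 2 * (n : ℝ) + (4 - α) ≠ 0 := fun h => hα (2 * n + 4) (by push_cast; linarith)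
    rw [e, ih, gammaCoeff_succ hα, show 3 / 2 - α / 2 + (n : ℝ) = (2 * n + (3 - α)) / 2 by ring,
      show 2 - α / 2 + (n : ℝ) = (2 * n + (4 - α)) / 2 by ring]
    push_cast
    field_simp
    ring

/-! ### The law of the SNR -/

theorem measurable_snrPDF (α β ρ₀ : ℝ) : Measurable (snrPDF α β ρ₀) := by
  unfold snrPDF
  exact Measurable.ite measurableSet_Ioi (by fun_prop) measurable_const

theorem snrPDF_of_notMem_Ioi {α β ρ₀ x : ℝ} (hx : x ∉ Ioi 0) : snrPDF α β ρ₀ x = 0 :=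
  if_neg hx

theorem snrPDF_nonneg {α β ρ₀ : ℝ} (hα : 0 < α) (hβ : 0 < β) (hρ₀ : 0 < ρ₀) (x : ℝ) :
    0 ≤ snrPDF α β ρ₀ x := by
  have := Real.Gamma_pos_of_pos hα
  unfold snrPDF
  split_ifs <;> positivity

/-- The substitution `x = β ^ 2 ρ₀ t ^ 2` turns the density into the Gamma density. -/
theorem snrPDF_comp_mul_sq {α β ρ₀ : ℝ} (hβ : 0 < β) (hρ₀ : 0 < ρ₀) {t : ℝ} (ht : 0 < t) :
    2 * t * (β ^ 2 * ρ₀ * snrPDF α β ρ₀ (β ^ 2 * ρ₀ * t ^ 2))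
      = (Real.Gamma α)⁻¹ * (t ^ (α - 1) * Real.exp (-t)) := by
  have e1 : Real.sqrt (β ^ 2 * ρ₀ * t ^ 2 / (β ^ 2 * ρ₀)) = t := by
    rw [mul_div_cancel_left₀ _ (by positivity), Real.sqrt_sq ht.le]
  have sq (y : ℝ) (hy : 0 < y) : (y ^ 2) ^ ((α - 2) / 2) = y ^ α / y ^ 2 := by
    rw [← Real.rpow_natCast y 2, ← Real.rpow_mul hy.le, ← Real.rpow_sub hy]
    congr 1; push_cast; ring
  have e3 : ρ₀ ^ ((α - 2) / 2) = ρ₀ ^ (α / 2) / ρ₀ := by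
    rw [← Real.rpow_sub_one hρ₀.ne']; ring_nf
  rw [snrPDF, if_pos (by positivity), e1, Real.mul_rpow (by positivity) (by positivity),
    Real.mul_rpow (by positivity) hρ₀.le, sq β hβ, sq t ht, e3, Real.rpow_neg hρ₀.le,
    Real.rpow_sub_one ht.ne']
  have := Real.rpow_pos_of_pos hβ α
  have := Real.rpow_pos_of_pos hρ₀ (α / 2)
  field_simp

theorem integral_snrPDF_mul {α β ρ₀ : ℝ} (hβ : 0 < β) (hρ₀ : 0 < ρ₀) (f : ℝ → ℝ) :
    ∫ x, snrPDF α β ρ₀ x * f x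
      = (Real.Gamma α)⁻¹ *
        ∫ t in Ioi (0 : ℝ), t ^ (α - 1) * Real.exp (-t) * f (β ^ 2 * ρ₀ * t ^ 2) := by
  have hz : 0 < β ^ 2 * ρ₀ := by positivity
  have h1 : ∫ x, snrPDF α β ρ₀ x * f x = ∫ x in Ioi (0 : ℝ), snrPDF α β ρ₀ x * f x := by
    refine (setIntegral_eq_integral_of_forall_compl_eq_zero fun x hx => ?_).symm
    rw [snrPDF_of_notMem_Ioi hx, zero_mul]
  have h2 := integral_comp_mul_left_Ioi (fun x => snrPDF α β ρ₀ x * f x) 0 hz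
  rw [mul_zero, smul_eq_mul, eq_inv_mul_iff_mul_eq₀ hz.ne'] at h2
  rw [h1, ← h2, ← integral_comp_rpow_Ioi_of_pos two_pos, ← integral_const_mul,
    ← integral_const_mul]
  refine setIntegral_congr_fun measurableSet_Ioi fun t ht => ?_
  have := snrPDF_comp_mul_sq (α := α) hβ hρ₀ ht
  simp only [smul_eq_mul, Real.rpow_two, show (2 : ℝ) - 1 = 1 by norm_num, Real.rpow_one]
  linear_combination f (β ^ 2 * ρ₀ * t ^ 2) * this

theorem integrable_snrPDF_mul {α β ρ₀ : ℝ} (hβ : 0 < β) (hρ₀ : 0 < ρ₀) {f : ℝ → ℝ}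
    (hf : IntegrableOn (fun t => t ^ (α - 1) * Real.exp (-t) * f (β ^ 2 * ρ₀ * t ^ 2)) (Ioi 0)) :
    Integrable fun x => snrPDF α β ρ₀ x * f x := by
  have hz : 0 < β ^ 2 * ρ₀ := by positivity
  have h1 : IntegrableOn (fun x => snrPDF α β ρ₀ x * f x) (Ioi 0) := by
    rw [← mul_zero (β ^ 2 * ρ₀), ← integrableOn_Ioi_comp_mul_left_iff _ _ hz,
      ← integrableOn_Ioi_comp_rpow_iff _ two_ne_zero]
    refine IntegrableOn.congr_fun (hf.const_mul ((β ^ 2 * ρ₀)⁻¹ * (Real.Gamma α)⁻¹))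
      (fun t ht => ?_) measurableSet_Ioi
    have := snrPDF_comp_mul_sq (α := α) hβ hρ₀ ht
    simp only [smul_eq_mul, Real.rpow_two, show (2 : ℝ) - 1 = 1 by norm_num, Real.rpow_one, abs_two]
    rw [mul_assoc, ← mul_assoc (Real.Gamma α)⁻¹, ← this]
    field_simp
  refine (integrableOn_iff_integrable_of_support_subset fun x hx => ?_).1 h1
  by_contra hx0
  exact hx (by simp only [snrPDF_of_notMem_Ioi hx0, zero_mul])

theorem isProbabilityMeasure_snrLaw {α β ρ₀ : ℝ} (hα : 0 < α) (hβ : 0 < β) (hρ₀ : 0 < ρ₀) :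
    IsProbabilityMeasure (snrLaw α β ρ₀) := by
  constructor
  have hi := integrable_snrPDF_mul (α := α) hβ hρ₀ (f := fun _ => 1) (by
    simpa using integrableOn_rpow_mul_exp_neg_mul (q := α - 1) (by linarith) one_pos)
  have hv := integral_snrPDF_mul (α := α) hβ hρ₀ (fun _ => 1)
  have hG := Real.integral_rpow_mul_exp_neg_mul_Ioi hα one_pos
  simp only [one_mul, div_one, Real.one_rpow] at hG
  simp only [mul_one] at hi hv
  rw [hG, inv_mul_cancel₀ (Real.Gamma_pos_of_pos hα).ne'] at hv
  rw [snrLaw, withDensity_apply _ MeasurableSet.univ, Measure.restrict_univ,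
    ← ofReal_integral_eq_lintegral_ofReal hi (Eventually.of_forall (snrPDF_nonneg hα hβ hρ₀)), hv,
    ENNReal.ofReal_one]

/-! ### The ergodic capacity -/

/-- The capacity in terms of `logIntegral`, with `c = (β √ρ₀)⁻¹`. -/
theorem integrable_and_integral_log_one_add_snr {α β ρ₀ c : ℝ} (hα : 0 < α) (hβ : 0 < β)
    (hρ₀ : 0 < ρ₀) (hc : 0 < c) (hc2 : c ^ 2 = 1 / (β ^ 2 * ρ₀)) :
    Integrable (fun x => Real.log (1 + x)) (snrLaw α β ρ₀) ∧
    ∫ x, Real.log (1 + x) ∂(snrLaw α β ρ₀)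
      = (Real.Gamma α)⁻¹ * (logIntegral α c - Real.Gamma α * Real.log (c ^ 2)) := by
  have hG := Real.integral_rpow_mul_exp_neg_mul_Ioi hα one_pos
  have hGi := integrableOn_rpow_mul_exp_neg_mul (q := α - 1) (by linarith) one_pos
  simp only [one_mul, div_one, Real.one_rpow] at hG hGi
  have e : ∀ t ∈ Ioi (0 : ℝ),
      t ^ (α - 1) * Real.exp (-t) * Real.log (c ^ 2 + t ^ 2)
        - t ^ (α - 1) * Real.exp (-t) * Real.log (c ^ 2)
      = t ^ (α - 1) * Real.exp (-t) * Real.log (1 + β ^ 2 * ρ₀ * t ^ 2) := by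
    intro t ht
    have ht : 0 < t := ht
    have : 1 + β ^ 2 * ρ₀ * t ^ 2 = (c ^ 2 + t ^ 2) / c ^ 2 := by
      rw [hc2]; field_simp
    rw [this, Real.log_div (by positivity) (by positivity)]
    ring
  have hLi := (integrableOn_logIntegral hα c).sub (hGi.mul_const (Real.log (c ^ 2)))
  have hfin : ∀ᵐ x : ℝ, ENNReal.ofReal (snrPDF α β ρ₀ x) < ⊤ :=
    Eventually.of_forall fun _ => ENNReal.ofReal_lt_top
  have hm := (measurable_snrPDF α β ρ₀).ennreal_ofReal
  have htoReal (x : ℝ) : (ENNReal.ofReal (snrPDF α β ρ₀ x)).toReal = snrPDF α β ρ₀ x :=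
    ENNReal.toReal_ofReal (snrPDF_nonneg hα hβ hρ₀ x)
  constructor
  · rw [snrLaw, integrable_withDensity_iff_integrable_smul' hm hfin]
    simp only [htoReal, smul_eq_mul]
    exact integrable_snrPDF_mul hβ hρ₀ (IntegrableOn.congr_fun hLi e measurableSet_Ioi)
  · rw [snrLaw, integral_withDensity_eq_integral_toReal_smul hm hfin]
    simp only [htoReal, smul_eq_mul]
    rw [integral_snrPDF_mul hβ hρ₀, ← setIntegral_congr_fun measurableSet_Ioi e,
      integral_sub (integrableOn_logIntegral hα c) (hGi.mul_const _), integral_mul_const, hG]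
    rfl

theorem capacityClosedForm_eq {α β ρ₀ c : ℝ} (h0 : 0 < α) (hα : ∀ n : ℕ, α ≠ n)
    (hc : 0 < c) (hc2 : c ^ 2 = 1 / (β ^ 2 * ρ₀)) :
    capacityClosedForm α β ρ₀ = 1 / Real.log 2 *
      ((Real.Gamma α)⁻¹ * (logIntegral α c - Real.Gamma α * Real.log (c ^ 2))) := by
  have hz : -(1 / (4 * β ^ 2 * ρ₀)) = -(c ^ 2 / 4) := by
    rw [hc2, div_div]; ring_nf
  have hpow (μ : ℝ) : (c ^ 2) ^ (μ / 2) = c ^ μ := by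
    rw [← Real.rpow_natCast c 2, ← Real.rpow_mul hc.le]; congr 1; push_cast; ring
  have hG0 := Gamma_sub_two_ne_zero h0 hα
  have hα1 : α - 1 ≠ 0 := sub_ne_zero.2 (by simpa using hα 1)
  have hα2 : α - 2 ≠ 0 := sub_ne_zero.2 (by simpa using hα 2)
  have hα3 : 1 + α ≠ 0 := by positivity
  have hG : Real.Gamma α = (α - 1) * ((α - 2) * Real.Gamma (α - 2)) := by
    rw [← Real.Gamma_add_one hα2, show α - 2 + 1 = α - 1 by ring, ← Real.Gamma_add_one hα1,
      sub_add_cancel]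
  have p1 : hypergeometricPFQ [α / 2] [1 / 2, 1 + α / 2] (-(c ^ 2 / 4))
      = α * ∑' n, cosCoeff α n * (c ^ 2) ^ n := by
    simp only [hypergeometricPFQ, hypergeometricTerm_eq_cosCoeff h0, mul_assoc, tsum_mul_left]
  have p2 : hypergeometricPFQ [1 / 2 + α / 2] [3 / 2, 3 / 2 + α / 2] (-(c ^ 2 / 4))
      = (1 + α) * ∑' n, sinCoeff α n * (c ^ 2) ^ n := by
    simp only [hypergeometricPFQ, hypergeometricTerm_eq_sinCoeff h0, mul_assoc, tsum_mul_left]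
  have p3 : hypergeometricPFQ [1, 1] [2, 3 / 2 - α / 2, 2 - α / 2] (-(c ^ 2 / 4))
      = 2 / Real.Gamma (α - 2) *
        ∑' n : ℕ, gammaCoeff α n / (2 * (n : ℝ) + 2) * (c ^ 2) ^ n := by
    simp only [hypergeometricPFQ, hypergeometricTerm_eq_gammaCoeff h0 hα, mul_assoc,
      tsum_mul_left]
  rw [capacityClosedForm, hz, ← hc2, p1, p2, p3, hpow, hpow, logIntegral_eq h0 hα hc,
    evenSeries_eq_rpow_mul _ _ hc, evenSeries_eq_rpow_mul _ _ hc, evenSeries_eq_rpow_mul _ _ hc,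
    hG, Real.rpow_two]
  congr 1
  simp only [div_eq_mul_inv, mul_inv]
  field_simp
  ring

/-- Ergodic capacity. The law with density `snrPDF` is a probability law, the three hypergeometric
series converge, and `E[log₂ (1 + ρ)]` exists and equals the closed form for every random variable
`ρ` with that law. The closed form has poles (of `csc`, `sec`, `Γ(α - 2)` or `₂F₃`) exactly when
the positive real `α` is an integer, and is undefined there. -/
theorem theorem2 (α β ρ₀ : ℝ) (hα : 0 < α) (hβ : 0 < β) (hρ₀ : 0 < ρ₀)
    (hα_int : ∀ n : ℕ, α ≠ n) :
    IsProbabilityMeasure (snrLaw α β ρ₀) ∧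
    Summable (hypergeometricTerm [α / 2] [1 / 2, 1 + α / 2] (-(1 / (4 * β ^ 2 * ρ₀)))) ∧
    Summable (hypergeometricTerm [1, 1] [2, 3 / 2 - α / 2, 2 - α / 2]
      (-(1 / (4 * β ^ 2 * ρ₀)))) ∧
    Summable (hypergeometricTerm [1 / 2 + α / 2] [3 / 2, 3 / 2 + α / 2]
      (-(1 / (4 * β ^ 2 * ρ₀)))) ∧
    ∀ {Ω : Type*} [MeasurableSpace Ω] (P : Measure Ω) (ρ : Ω → ℝ),
      HasLaw ρ (snrLaw α β ρ₀) P →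
        Integrable (fun ω => Real.logb 2 (1 + ρ ω)) P ∧
        ∫ ω, Real.logb 2 (1 + ρ ω) ∂P = capacityClosedForm α β ρ₀ := by
  have hc : 0 < 1 / (β * Real.sqrt ρ₀) := by positivity
  have hc2 : (1 / (β * Real.sqrt ρ₀)) ^ 2 = 1 / (β ^ 2 * ρ₀) := by
    rw [div_pow, mul_pow, Real.sq_sqrt hρ₀.le, one_pow]
  have hz : -(1 / (4 * β ^ 2 * ρ₀)) = -(1 / (β ^ 2 * ρ₀) / 4) := by
    rw [div_div]; ring_nf
  refine ⟨isProbabilityMeasure_snrLaw hα hβ hρ₀, ?_, ?_, ?_, ?_⟩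
  · rw [hz]
    refine ((summable_cosCoeff_mul_pow hα (1 / (β ^ 2 * ρ₀))).mul_left α).congr fun n => ?_
    rw [hypergeometricTerm_eq_cosCoeff hα, mul_assoc]
  · rw [hz]
    refine ((summable_gammaCoeff_div_mul_pow hα_int (1 / (β ^ 2 * ρ₀))).mul_left
      (2 / Real.Gamma (α - 2))).congr fun n => ?_
    rw [hypergeometricTerm_eq_gammaCoeff hα hα_int, mul_assoc]
  · rw [hz]
    refine ((summable_sinCoeff_mul_pow hα (1 / (β ^ 2 * ρ₀))).mul_left (1 + α)).congr fun n => ?_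
    rw [hypergeometricTerm_eq_sinCoeff hα, mul_assoc]
  · intro Ω _ P ρ hρ
    obtain ⟨hi, hv⟩ := integrable_and_integral_log_one_add_snr hα hβ hρ₀ hc hc2
    have hi2 : Integrable (fun x => Real.logb 2 (1 + x)) (snrLaw α β ρ₀) :=
      hi.div_const (Real.log 2)
    constructor
    · have h := hi2
      rw [← hρ.map_eq] at h
      exact h.comp_aemeasurable hρ.aemeasurable
    · have h := hρ.integral_comp hi2.aestronglyMeasurable
      rw [capacityClosedForm_eq hα hα_int hc hc2, ← hv]
      refine h.trans ?_
      simp only [Real.logb]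
      rw [integral_div, one_div, inv_mul_eq_div]
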